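/- For a finite simple graph $G$ let $c(G)$ be the number of cycles in $G$, that is, the number of subgraphs of $G$ that are cycles (of any length at least $3$). For a finite simple graph $H$, a graph is called $H$-free if it contains no (not necessarily induced) subgraph isomorphic to $H$, and we put $m(n;H)=\max\{c(G) : |V(G)|=n,\ G \text{ is } H\text{-free}\}$. **Theorem.** Let $k\ge 2$ and let $H$ be a fixed finite simple graph with chromatic number $\chi(H)=k+1$. Then $$m(n;H)\le\left(\frac{k-1}{k}\right)^n n^n e^{-(1-o(1))n},$$ where $o(1)$ denotes a real-valued function of $n$ (which may depend on $H$) that tends to $0$ as $n\to\infty$. -/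

import Mathlib

open Filter Topology

/-- The cycles of `G`, as subgraphs of `G`: those subgraphs that are traced out by a closed walk
of length at least three which repeats no edge and no vertex other than its endpoint.
Base point and orientation are forgotten, so each cycle occurs exactly once. -/
def cycleSubgraphs {V : Type*} (G : SimpleGraph V) : Set G.Subgraph :=
  {C | ∃ (v : V) (p : G.Walk v v), p.IsCycle ∧ p.toSubgraph = C}

/-- `c(G)`, the number of cycles of the finite graph `G`. -/
noncomputable def cycleCount {V : Type*} [Finite V] (G : SimpleGraph V) : ℕ :=
  (cycleSubgraphs G).ncard

open Classical in
/-- `m(n; H)`, the maximum of `c(G)` over all graphs `G` on `n` vertices that contain no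
(not necessarily induced) subgraph isomorphic to `H`. -/
noncomputable def maxCycleCount {W : Type*} (n : ℕ) (H : SimpleGraph W) : ℕ :=
  (Finset.univ.filter fun G : SimpleGraph (Fin n) => H.Free G).sup fun G => cycleCount G

/-! Orienting a cycle gives a permutation moving each vertex to itself or to a neighbour, and the
permutation determines the cycle. Hence `c(G)` is at most the permanent of the adjacency matrix plus
the identity. Brégman's theorem bounds this by a product of `((d + 1)!) ^ (1 / (d + 1))` over the
degrees `d`, and each factor is about `d / e` by Stirling. Concavity of `log` replaces `d` by the
average degree, which Erdős–Stone bounds by `(1 - 1 / k + o(1)) * n`. -/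

/-! ### Edge density of `H`-free graphs -/

namespace SimpleGraph

/-- An edge form of the Erdős–Stone theorem: the extremal number of an `(r + 1)`-colorable graph is
at most `(1 - 1 / r + ε) * n.choose 2` up to lower-order terms. -/
theorem eventually_extremalNumber_le {W : Type*} [Finite W] {H : SimpleGraph W} {r : ℕ}
    (hr : 1 ≤ r) (hH : H.Colorable (r + 1)) {ε : ℝ} (hε : 0 < ε) :
    ∃ N : ℕ, ∀ n ≥ N, (extremalNumber n H : ℝ) ≤
      extremalNumber N H + (1 - 1 / (r : ℝ) + ε) * (n * (n + 1) / 2) := by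
  classical
  have := Fintype.ofFinite W
  obtain ⟨c⟩ := hH
  have hcont : H ⊑ completeEquipartiteGraph (r + 1) (Fintype.card W) :=
    isContained_completeEquipartiteGraph_of_colorable c _ fun _ => Fintype.card_subtype_le _
  obtain ⟨N, hN⟩ := eventually_atTop.mp
    (eventually_completeEquipartiteGraph_isContained_of_minDegree hε r (Fintype.card W))
  have hr' : 1 / (r : ℝ) ≤ 1 := by
    rw [div_le_one (by positivity)]
    exact_mod_cast hr
  have hnonneg : 0 ≤ 1 - 1 / (r : ℝ) + ε := by linarith
  refine ⟨N, fun n hn => ?_⟩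
  induction n, hn using Nat.le_induction with
  | base => exact le_add_of_nonneg_right (by positivity)
  | succ n hn ih =>
    -- A larger minimum degree would force a copy of `H`, so deleting a vertex of minimum degree
    -- loses few edges.
    have hstep : (extremalNumber (n + 1) H : ℝ) ≤
        extremalNumber n H + (1 - 1 / (r : ℝ) + ε) * (n + 1) := by
      rw [← Fintype.card_fin (n + 1), extremalNumber_le_iff_of_nonneg H (by positivity)]
      intro G _ hG
      have hdeg : (G.minDegree : ℝ) < (1 - 1 / (r : ℝ) + ε) * ((n + 1 : ℕ) : ℝ) := by
        by_contra! h
        exact hG (hcont.trans (hN (n + 1) (by lia) h))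
      obtain ⟨v, hv⟩ := G.exists_minimal_degree_vertex
      have hdel := card_edgeFinset_deleteIncidenceSet_le_extremalNumber hG v
      rw [card_edgeFinset_deleteIncidenceSet, Fintype.card_fin, Nat.add_sub_cancel, ← hv] at hdel
      have hdel' : (G.edgeFinset.card : ℝ) ≤ extremalNumber n H + G.minDegree := by
        exact_mod_cast Nat.sub_le_iff_le_add.mp hdel
      push_cast at hdeg
      linarith
    push_cast
    linarith

end SimpleGraph

/-! ### Brégman's theorem -/

open Finset in
-- Jensen's inequality for `x * log x` with uniform weights.
theorem Finset.sum_mul_log_sum_le {κ : Type*} (s : Finset κ) (f : κ → ℝ) (hf : ∀ k ∈ s, 0 ≤ f k) :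
    (∑ k ∈ s, f k) * Real.log (∑ k ∈ s, f k) ≤
      (∑ k ∈ s, f k) * Real.log #s + ∑ k ∈ s, f k * Real.log (f k) := by
  rcases s.eq_empty_or_nonempty with rfl | hs
  · simp
  have hs0 : (0 : ℝ) < #s := by exact_mod_cast hs.card_pos
  rcases (sum_nonneg hf).eq_or_lt with h0 | hpos
  · have h := (sum_eq_zero_iff_of_nonneg hf).mp h0.symm
    rw [sum_eq_zero (f := fun k => f k * Real.log (f k)) fun k hk => by simp [h k hk], ← h0]
    simp
  have h := Real.convexOn_mul_log.map_sum_le (t := s) (w := fun _ => (#s : ℝ)⁻¹) (p := f)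
    (fun _ _ => by positivity) (by simp [hs0.ne']) (fun k hk => hf k hk)
  simp only [smul_eq_mul, ← mul_sum] at h
  rw [Real.log_mul (by positivity) hpos.ne', Real.log_inv, mul_assoc] at h
  have h' := le_of_mul_le_mul_left h (by positivity)
  linarith

/-- `log (r!) / r`, the logarithm of the factor which a row with `r` ones contributes to Brégman's
bound. -/
noncomputable def bregmanLog (r : ℕ) : ℝ := Real.log (r.factorial : ℝ) / r

theorem bregmanLog_nonneg (r : ℕ) : 0 ≤ bregmanLog r :=
  div_nonneg (Real.log_natCast_nonneg _) r.cast_nonneg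

theorem mul_bregmanLog (r : ℕ) : r * bregmanLog r = Real.log (r.factorial : ℝ) := by
  rcases eq_or_ne r 0 with rfl | hr
  · simp
  · rw [bregmanLog, mul_div_cancel₀]
    exact_mod_cast hr

theorem log_add_mul_bregmanLog_pred {r : ℕ} (hr : r ≠ 0) :
    Real.log r + ((r : ℝ) - 1) * bregmanLog (r - 1) = r * bregmanLog r := by
  obtain ⟨m, rfl⟩ := Nat.exists_eq_succ_of_ne_zero hr
  have h := mul_bregmanLog m
  rw [mul_bregmanLog, Nat.factorial_succ, Nat.cast_mul, Real.log_mul (by positivity) (by positivity)]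
  simp [h]

open Classical Finset in
/-- The bijections `σ : ι ≃ κ` with `R i (σ i)` for all `i`. Their number is the permanent of the
`0`-`1` matrix of `R`. -/
noncomputable def compatibleEquivs {ι κ : Type*} [Fintype ι] [Fintype κ] (R : ι → κ → Prop) :
    Finset (ι ≃ κ) := univ.filter fun σ => ∀ i, R i (σ i)

open Classical Finset in
/-- **Brégman's theorem** on permanents of `0`-`1` matrices, in logarithmic form. The proof is the
one by Schrijver. -/
theorem log_card_compatibleEquivs_le {ι κ : Type*} [Fintype ι] [Fintype κ] (R : ι → κ → Prop) :
    Real.log #(compatibleEquivs R) ≤ ∑ i, bregmanLog #{k | R i k} := by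
  obtain ⟨n, hn⟩ : ∃ n, Fintype.card ι = n := ⟨_, rfl⟩
  induction n generalizing ι κ with
  | zero =>
    have := Fintype.card_eq_zero_iff.mp hn
    have : #(compatibleEquivs R) ≤ 1 := card_le_one.mpr fun σ _ τ _ => Equiv.ext isEmptyElim
    refine (Real.log_nonpos (by positivity) (by exact_mod_cast this)).trans ?_
    exact sum_nonneg fun i _ => bregmanLog_nonneg _
  | succ n ih =>
    set A := compatibleEquivs R with hA
    have hmem {σ : ι ≃ κ} : σ ∈ A ↔ ∀ i, R i (σ i) := by simp [hA, compatibleEquivs]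
    rcases A.eq_empty_or_nonempty with h0 | ⟨σ₀, hσ₀⟩
    · rw [h0]
      simpa using sum_nonneg fun i _ => bregmanLog_nonneg _
    have hκ : Fintype.card κ = n + 1 := by rw [← hn, Fintype.card_congr σ₀]
    set r : ι → ℕ := fun i => #{k | R i k} with hr
    -- The contribution of row `j` to the bound once column `k` is deleted.
    let g : ι → κ → ℝ := fun j k => bregmanLog (if R j k then r j - 1 else r j)
    let N : ι → κ → ℕ := fun i k => #{σ ∈ A | σ i = k}
    have hN (i : ι) (k : κ) (hik : R i k) (hpos : 0 < N i k) :
        Real.log (N i k) ≤ ∑ j ∈ univ.erase i, g j k := by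
      let R' : {j // j ≠ i} → {l // l ≠ k} → Prop := fun j l => R j l
      have hcard : N i k ≤ #(compatibleEquivs R') := by
        -- Each bijection of the minor is sent to its extension by `i ↦ k`; the default `σ₀` is
        -- irrelevant to surjectivity.
        refine card_le_card_of_surjOn
          (fun τ => if h : ∃ σ : ι ≃ κ, σ i = k ∧ ∀ j : {j // j ≠ i}, σ j = τ j then h.choose else σ₀) ?_
        intro σ hσ
        simp only [coe_filter, Set.mem_ofPred_eq, hmem] at hσ
        obtain ⟨hσR, hσi⟩ := hσ
        let τ : {j // j ≠ i} ≃ {l // l ≠ k} := σ.subtypeEquiv fun a => by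
          rw [← hσi]; exact σ.injective.ne_iff.symm
        have h : ∃ σ : ι ≃ κ, σ i = k ∧ ∀ j : {j // j ≠ i}, σ j = τ j := ⟨σ, hσi, fun _ => rfl⟩
        refine ⟨τ, ?_, ?_⟩
        · simp only [compatibleEquivs, coe_filter, mem_univ, true_and, Set.mem_ofPred_eq]
          exact fun j => hσR j
        · simp only [dif_pos h]
          ext j
          by_cases hj : j = i
          · rw [hj, h.choose_spec.1, hσi]
          · exact h.choose_spec.2 ⟨j, hj⟩
      have hcard' : Fintype.card {j // j ≠ i} = n := by simp [Fintype.card_subtype_compl, hn]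
      refine (Real.log_le_log (by exact_mod_cast hpos) (by exact_mod_cast hcard)).trans
        ((ih R' hcard').trans_eq ?_)
      rw [← sum_subtype (univ.erase i) (p := (· ≠ i)) (by simp)
        (fun j => bregmanLog #{l : {l // l ≠ k} | R j l})]
      refine sum_congr rfl fun j _ => ?_
      simp only [g]
      congr 1
      have : #{l : {l // l ≠ k} | R j l} = #(({l | R j l} : Finset κ).erase k) := by
        rw [← card_map (Function.Embedding.subtype _)]
        congr 1
        ext l
        simp [and_comm]
      rw [this, card_erase_eq_ite]
      simp [hr]
    have hcount (i : ι) (f : κ → ℝ) :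
        ∑ σ ∈ A, f (σ i) = ∑ k ∈ {k | R i k}, (N i k : ℝ) * f k := by
      rw [← sum_fiberwise_of_maps_to (g := fun σ : ι ≃ κ => σ i) (t := {k | R i k})
        fun σ hσ => by simpa using hmem.mp hσ i]
      refine sum_congr rfl fun k _ => ?_
      rw [sum_congr rfl (g := fun _ => f k) fun σ hσ => by rw [(mem_filter.mp hσ).2]]
      simp [N]
    -- Expansion along row `i`: Jensen over its ones, then induction on each minor.
    have hrow (i : ι) : (#A : ℝ) * Real.log #A ≤
        ∑ σ ∈ A, (Real.log (r i) + ∑ j ∈ univ.erase i, g j (σ i)) := by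
      have hsum : (#A : ℝ) = ∑ k ∈ {k | R i k}, (N i k : ℝ) := by
        simpa using hcount i fun _ => 1
      have h := sum_mul_log_sum_le ({k | R i k} : Finset κ) (fun k => (N i k : ℝ))
        fun _ _ => by positivity
      rw [← hsum] at h
      rw [sum_add_distrib, sum_const, nsmul_eq_mul, hcount i fun k => ∑ j ∈ univ.erase i, g j k]
      refine h.trans (add_le_add le_rfl (sum_le_sum fun k hk => ?_))
      rcases Nat.eq_zero_or_pos (N i k) with h0 | hpos
      · simp [h0]
      · exact mul_le_mul_of_nonneg_left (hN i k (by simpa using hk) hpos) (by positivity)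
    -- As `i ≠ j` varies, `σ i` runs through all columns but `σ j`: `r j - 1` of them meet a one of
    -- row `j` and `n + 1 - r j` a zero.
    have hcol (σ : ι ≃ κ) (hσ : σ ∈ A) (j : ι) :
        Real.log (r j) + ∑ i ∈ univ.erase j, g j (σ i) = (n + 1) * bregmanLog (r j) := by
      have hj : R j (σ j) := hmem.mp hσ j
      have hrj : r j ≠ 0 := (card_pos.mpr ⟨σ j, by simpa using hj⟩).ne'
      have h1 : ∑ i ∈ univ.erase j, g j (σ i) = ∑ k, g j k - g j (σ j) := by
        rw [← σ.sum_comp (g j), ← sum_erase_add univ _ (mem_univ j)]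
        ring
      have h2 : ∑ k, g j k = r j * bregmanLog (r j - 1) + (n + 1 - r j) * bregmanLog (r j) := by
        have hc : #{k | R j k} + #{k | ¬ R j k} = n + 1 := by
          rw [card_filter_add_card_filter_not, card_univ, hκ]
        have hc' : (#{k | ¬ R j k} : ℝ) = n + 1 - r j := by
          rw [eq_sub_iff_add_eq']
          exact_mod_cast hc
        simp only [g, apply_ite bregmanLog]
        rw [sum_ite, sum_const, sum_const, nsmul_eq_mul, nsmul_eq_mul, hc']
      have h3 : g j (σ j) = bregmanLog (r j - 1) := by simp [g, hj]
      rw [h1, h2, h3]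
      linear_combination log_add_mul_bregmanLog_pred hrj
    have htotal : (n + 1) * ((#A : ℝ) * Real.log #A) ≤
        (n + 1) * (#A * ∑ j, bregmanLog (r j)) := by
      calc (n + 1) * ((#A : ℝ) * Real.log #A)
          = ∑ _i : ι, (#A : ℝ) * Real.log #A := by simp [hn]
        _ ≤ ∑ i, ∑ σ ∈ A, (Real.log (r i) + ∑ j ∈ univ.erase i, g j (σ i)) :=
          sum_le_sum fun i _ => hrow i
        _ = ∑ σ ∈ A, ∑ j, (Real.log (r j) + ∑ i ∈ univ.erase j, g j (σ i)) := by
          rw [sum_comm]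
          refine sum_congr rfl fun σ _ => ?_
          rw [sum_add_distrib, sum_add_distrib]
          congr 1
          exact sum_comm' (by simp [eq_comm])
        _ = ∑ σ ∈ A, ∑ j, (n + 1) * bregmanLog (r j) :=
          sum_congr rfl fun σ hσ => sum_congr rfl fun j _ => hcol σ hσ j
        _ = (n + 1) * (#A * ∑ j, bregmanLog (r j)) := by
          rw [sum_const, nsmul_eq_mul, ← mul_sum]
          ring
    have hA0 : (0 : ℝ) < #A := by exact_mod_cast card_pos.mpr ⟨σ₀, hσ₀⟩
    exact le_of_mul_le_mul_left (le_of_mul_le_mul_left htotal (by positivity)) hA0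

/-! ### Cycles as permutations -/

namespace SimpleGraph

variable {V : Type*} {G : SimpleGraph V}

/-- The subgraph of `G` consisting of the points moved by `σ` and the edges `{x, σ x}`. -/
def subgraphOfPerm (G : SimpleGraph V) (σ : Equiv.Perm V) : G.Subgraph where
  verts := {x | σ x ≠ x}
  Adj x y := G.Adj x y ∧ (σ x = y ∨ σ y = x)
  adj_sub h := h.1
  edge_vert := by
    rintro x y ⟨hadj, rfl | h⟩ hx
    · exact hadj.ne hx.symm
    · exact hadj.ne (σ.injective (hx.trans h.symm))
  symm := ⟨fun _ _ h => ⟨h.1.symm, h.2.symm⟩⟩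

theorem Walk.IsCycle.exists_perm {v : V} {p : G.Walk v v} (hp : p.IsCycle) :
    ∃ σ : Equiv.Perm V, (∀ i < p.length, σ (p.getVert i) = p.getVert (i + 1)) ∧
      ∀ x ∉ p.support, σ x = x := by
  classical
  have h3 := hp.three_le_length
  have hlen : p.support.tail.length = p.length := by simp
  have hget (i : ℕ) (hi : i < p.support.tail.length) : p.support.tail[i] = p.getVert (i + 1) := by
    rw [List.getElem_tail, Walk.support_getElem_eq_getVert]
  refine ⟨p.support.tail.formPerm, fun i hi => ?_, fun x hx => ?_⟩
  -- The tail lists the base point only as its last entry, so the step from index `0` is the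
  -- wrap-around of `formPerm`.
  · rcases i with - | j
    · have h := List.formPerm_apply_getElem _ hp.support_nodup (p.length - 1) (by lia)
      simp only [hget] at h
      rw [show p.length - 1 + 1 = p.length by lia, hlen, Nat.mod_self, Walk.getVert_length] at h
      rw [Walk.getVert_zero, h]
    · have h := List.formPerm_apply_getElem _ hp.support_nodup j (by lia)
      simp only [hget] at h
      rwa [hlen, Nat.mod_eq_of_lt hi] at h
  · exact List.formPerm_apply_of_notMem fun h => hx (List.mem_of_mem_tail h)

theorem Walk.IsCycle.exists_subgraphOfPerm_eq {v : V} {p : G.Walk v v} (hp : p.IsCycle) :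
    ∃ σ : Equiv.Perm V, (∀ x, x = σ x ∨ G.Adj x (σ x)) ∧ G.subgraphOfPerm σ = p.toSubgraph := by
  obtain ⟨σ, hσ, hfix⟩ := hp.exists_perm
  have h3 := hp.three_le_length
  have hsupp {x : V} (hx : x ∈ p.support) : ∃ i < p.length, p.getVert i = x := by
    obtain ⟨i, rfl, hi⟩ := Walk.mem_support_iff_exists_getVert.mp hx
    rcases hi.eq_or_lt with rfl | hi
    · exact ⟨0, by lia, by simp⟩
    · exact ⟨i, hi, rfl⟩
  have hadj {x y : V} (hxy : σ x = y) (hne : x ≠ y) : p.toSubgraph.Adj x y := by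
    have hx : x ∈ p.support := by
      by_contra hx
      exact hne ((hfix x hx).symm.trans hxy)
    obtain ⟨i, hi, rfl⟩ := hsupp hx
    rw [← hxy, hσ i hi]
    exact p.toSubgraph_adj_getVert hi
  refine ⟨σ, fun x => ?_, ?_⟩
  · by_cases hx : x = σ x
    · exact .inl hx
    · exact .inr (hadj rfl hx).adj_sub
  · ext x y
    · rw [Walk.mem_verts_toSubgraph]
      refine ⟨fun hx => not_imp_comm.mp (hfix x) hx, fun hx => ?_⟩
      obtain ⟨i, hi, rfl⟩ := hsupp hx
      change σ _ ≠ _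
      rw [hσ i hi]
      exact (p.adj_getVert_succ hi).ne'
    · refine ⟨?_, fun h => ⟨h.adj_sub, ?_⟩⟩
      · rintro ⟨h, hxy | hxy⟩
        · exact hadj hxy h.ne
        · exact (hadj hxy h.ne').symm
      · obtain ⟨i, he, hi⟩ := p.toSubgraph_adj_iff.mp h
        rw [Sym2.eq_iff] at he
        rcases he with ⟨rfl, rfl⟩ | ⟨rfl, rfl⟩
        · exact .inl (hσ i hi)
        · exact .inr (hσ i hi)

/-- `subgraphOfPerm` maps the compatible permutations onto a set containing every cycle; its surplus
values do no harm. -/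
theorem cycleCount_le_card_compatibleEquivs [Fintype V] (G : SimpleGraph V) :
    cycleCount G ≤ (compatibleEquivs fun x y => x = y ∨ G.Adj x y).card := by
  classical
  rw [cycleCount, ← Set.ncard_coe_finset]
  refine (Set.ncard_le_ncard ?_ (Set.toFinite _)).trans
    (Set.ncard_image_le (f := G.subgraphOfPerm) (Set.toFinite _))
  rintro C ⟨v, p, hp, rfl⟩
  obtain ⟨σ, hσ, h⟩ := hp.exists_subgraphOfPerm_eq
  exact ⟨σ, by simpa [compatibleEquivs] using hσ, h⟩

open Classical in
theorem log_cycleCount_le [Fintype V] (G : SimpleGraph V) :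
    Real.log (cycleCount G) ≤ ∑ v, bregmanLog (G.degree v + 1) := by
  rcases Nat.eq_zero_or_pos (cycleCount G) with h0 | hpos
  · rw [h0]
    simpa using Finset.sum_nonneg fun v _ => bregmanLog_nonneg _
  refine (Real.log_le_log (by exact_mod_cast hpos)
    (by exact_mod_cast cycleCount_le_card_compatibleEquivs G)).trans
    ((log_card_compatibleEquivs_le _).trans_eq (Finset.sum_congr rfl fun v _ => ?_))
  congr 1
  rw [← card_neighborFinset_eq_degree, ← Finset.card_insert_of_notMem (a := v) (by simp)]
  congr 1
  ext w
  simp [eq_comm]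

end SimpleGraph

/-! ### Stirling's estimate and averaging -/

theorem Nat.log_factorial_le (r : ℕ) :
    Real.log (r.factorial : ℝ) ≤ (r + 1) * Real.log (r + 1) - r := by
  induction r with
  | zero => simp
  | succ r ih =>
    have h := Real.log_le_sub_one_of_pos (x := ((r : ℝ) + 1) / (r + 2)) (by positivity)
    rw [Real.log_div (by positivity) (by positivity)] at h
    have h' := mul_le_mul_of_nonneg_left h (show (0 : ℝ) ≤ r + 2 by positivity)
    rw [show ((r : ℝ) + 2) * ((r + 1) / (r + 2) - 1) = -1 by field_simp; ring] at h'
    rw [Nat.factorial_succ, Nat.cast_mul, Real.log_mul (by positivity) (by positivity)]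
    push_cast
    rw [show (r : ℝ) + 1 + 1 = r + 2 by ring]
    linarith

/-- The shift `C` absorbs small `r`, so that the bound holds for every degree and can be averaged.
-/
theorem exists_bregmanLog_le {δ : ℝ} (hδ : 0 < δ) :
    ∃ C : ℝ, 0 < C ∧ ∀ r : ℕ, bregmanLog r ≤ Real.log (r + C) - 1 + δ := by
  have hlim : Tendsto (fun r : ℕ => Real.log (r + 1) / r) atTop (𝓝 0) := by
    have h1 : Tendsto (fun r : ℕ => Real.log ((r : ℝ) + 1) / ((r : ℝ) + 1)) atTop (𝓝 0) :=
      (Real.isLittleO_log_id_atTop.tendsto_div_nhds_zero).comp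
        (tendsto_natCast_atTop_atTop.atTop_add tendsto_const_nhds)
    have h2 : Tendsto (fun r : ℕ => 1 + 1 / (r : ℝ)) atTop (𝓝 (1 + 0)) :=
      tendsto_const_nhds.add tendsto_one_div_atTop_nhds_zero_nat
    have h := h1.mul h2
    rw [zero_mul] at h
    refine h.congr' ?_
    filter_upwards [eventually_gt_atTop 0] with r hr
    have : (0 : ℝ) < r := by exact_mod_cast hr
    field_simp
  obtain ⟨R, hR⟩ := eventually_atTop.mp (hlim.eventually (gt_mem_nhds hδ))
  -- Chosen so that `log C - 1 = log R!`, which dominates `bregmanLog r` for `r < R`.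
  refine ⟨Real.exp (1 + Real.log (R.factorial : ℝ)), by positivity, fun r => ?_⟩
  set C := Real.exp (1 + Real.log (R.factorial : ℝ)) with hC
  have hfac : 0 ≤ Real.log (R.factorial : ℝ) := Real.log_natCast_nonneg _
  have hC1 : 1 ≤ C := Real.one_le_exp (by linarith)
  rcases Nat.eq_zero_or_pos r with rfl | hr0
  · simp only [bregmanLog, Nat.cast_zero, div_zero, zero_add, hC, Real.log_exp]
    linarith
  have hr0' : (0 : ℝ) < r := by exact_mod_cast hr0
  rcases le_or_gt R r with hr | hr
  · have h1 : bregmanLog r ≤ Real.log (r + 1) - 1 + Real.log (r + 1) / r := by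
      rw [bregmanLog, div_le_iff₀ hr0']
      refine (Nat.log_factorial_le r).trans_eq ?_
      field_simp
      ring
    have h2 : Real.log ((r : ℝ) + 1) ≤ Real.log (r + C) := Real.log_le_log (by positivity) (by linarith)
    linarith [hR r hr]
  · have h1 : bregmanLog r ≤ Real.log (R.factorial : ℝ) := by
      refine (div_le_self (Real.log_natCast_nonneg _) (by exact_mod_cast hr0)).trans ?_
      exact Real.log_le_log (by positivity) (by exact_mod_cast Nat.factorial_le hr.le)
    have h2 : Real.log C ≤ Real.log (r + C) := Real.log_le_log (by positivity) (by linarith)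
    rw [hC, Real.log_exp, ← hC] at h2
    linarith

/-- By concavity of the logarithm, Brégman's bound is governed by the average row sum. -/
theorem sum_bregmanLog_le {ι : Type*} (s : Finset ι) (r : ι → ℕ) {δ C a : ℝ}
    (hC : 0 < C) (h : ∀ r : ℕ, bregmanLog r ≤ Real.log (r + C) - 1 + δ) (ha : 0 < a)
    (hsum : ∑ i ∈ s, ((r i : ℝ) + C) ≤ s.card * a) :
    ∑ i ∈ s, bregmanLog (r i) ≤ s.card * (Real.log a - 1 + δ) := by
  -- The tangent line to `log` at `a`.
  have hle (i : ι) : bregmanLog (r i) ≤ (Real.log a - 2 + δ) + (r i + C) / a := by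
    have := Real.log_le_sub_one_of_pos (x := ((r i : ℝ) + C) / a) (by positivity)
    rw [Real.log_div (by positivity) ha.ne'] at this
    linarith [h (r i)]
  refine (Finset.sum_le_sum fun i _ => hle i).trans ?_
  rw [Finset.sum_add_distrib, ← Finset.sum_div, Finset.sum_const, nsmul_eq_mul]
  have : (∑ i ∈ s, ((r i : ℝ) + C)) / a ≤ s.card := by rwa [div_le_iff₀ ha]
  linarith

/-! ### The asymptotic bound -/

open Classical in
theorem SimpleGraph.eventually_sum_degree_add_le {W : Type*} [Finite W] {H : SimpleGraph W} {r : ℕ}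
    (hr : 1 ≤ r) (hH : H.Colorable (r + 1)) {ε : ℝ} (hε : 0 < ε) (C : ℝ) :
    ∀ᶠ n : ℕ in atTop, ∀ G : SimpleGraph (Fin n), H.Free G →
      ∑ v, ((G.degree v : ℝ) + C) ≤ (1 - 1 / (r : ℝ) + ε) * n ^ 2 := by
  obtain ⟨N, hN⟩ := eventually_extremalNumber_le hr hH (half_pos hε)
  set b : ℝ := 1 - 1 / (r : ℝ) + ε / 2 with hb
  set D : ℝ := 2 * extremalNumber N H with hD
  -- Beyond `M`, the terms of order at most `n` fit into `ε / 2 * n ^ 2`.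
  obtain ⟨M, hM⟩ := exists_nat_gt ((|D| + |b| + |C|) * (2 / ε))
  filter_upwards [eventually_ge_atTop N, eventually_ge_atTop M, eventually_ge_atTop 1]
    with n hnN hnM hn1 G hG
  have hn1' : (1 : ℝ) ≤ n := by exact_mod_cast hn1
  have hnM' : (|D| + |b| + |C|) * (2 / ε) ≤ n := hM.le.trans (by exact_mod_cast hnM)
  have hlow : |D| + |b| + |C| ≤ ε / 2 * n := by
    have := mul_le_mul_of_nonneg_left hnM' (half_pos hε).le
    rwa [show ε / 2 * ((|D| + |b| + |C|) * (2 / ε)) = |D| + |b| + |C| by field_simp] at this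
  have hedges : (G.edgeFinset.card : ℝ) ≤ extremalNumber n H := by
    have := card_edgeFinset_le_extremalNumber hG
    rw [Fintype.card_fin] at this
    exact_mod_cast this
  have hdeg : ∑ v, (G.degree v : ℝ) = 2 * G.edgeFinset.card := by
    exact_mod_cast G.sum_degrees_eq_twice_card_edges
  rw [Finset.sum_add_distrib, hdeg, Finset.sum_const, Finset.card_univ, Fintype.card_fin,
    nsmul_eq_mul]
  have h1 : D ≤ |D| * n := (le_abs_self D).trans (le_mul_of_one_le_right (abs_nonneg D) hn1')
  have h2 := mul_le_mul_of_nonneg_right hlow (show (0 : ℝ) ≤ n by positivity)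
  have h3 := mul_le_mul_of_nonneg_right (le_abs_self b) (show (0 : ℝ) ≤ n by positivity)
  have h4 := mul_le_mul_of_nonneg_right (le_abs_self C) (show (0 : ℝ) ≤ n by positivity)
  have h5 := hN n hnN
  rw [show 1 - 1 / (r : ℝ) + ε = b + ε / 2 by rw [hb]; ring]
  nlinarith

theorem eventually_maxCycleCount_le {W : Type*} [Finite W] {H : SimpleGraph W} {k : ℕ} (hk : 2 ≤ k)
    (hH : H.Colorable (k + 1)) {δ : ℝ} (hδ : 0 < δ) :
    ∀ᶠ n : ℕ in atTop, (maxCycleCount n H : ℝ) ≤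
      Real.exp (n * (Real.log (((k : ℝ) - 1) / k * n) - 1 + δ)) := by
  classical
  obtain ⟨C, hC, hbreg⟩ := exists_bregmanLog_le (half_pos hδ)
  have hk' : (2 : ℝ) ≤ k := by exact_mod_cast hk
  set c : ℝ := ((k : ℝ) - 1) / k with hc
  have hc0 : 0 < c := div_pos (by linarith) (by linarith)
  have hck : 1 - 1 / (k : ℝ) = c := by rw [hc]; field_simp
  -- The `1` in `1 + C` counts the diagonal entry of each row; the slack `c * (δ / 2)` becomes a
  -- factor `1 + δ / 2`, costing at most `δ / 2` in the logarithm.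
  filter_upwards [SimpleGraph.eventually_sum_degree_add_le (by lia) hH
    (mul_pos hc0 (half_pos hδ)) (1 + C), eventually_ge_atTop 1] with n hn hn1
  have hn0 : (0 : ℝ) < n := by exact_mod_cast hn1
  have hG (G : SimpleGraph (Fin n)) (hfree : H.Free G) :
      (cycleCount G : ℝ) ≤ Real.exp (n * (Real.log (c * n) - 1 + δ)) := by
    rcases Nat.eq_zero_or_pos (cycleCount G) with h0 | hpos
    · rw [h0, Nat.cast_zero]
      positivity
    rw [← Real.log_le_iff_le_exp (by exact_mod_cast hpos)]
    refine (SimpleGraph.log_cycleCount_le G).trans ?_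
    have h := sum_bregmanLog_le Finset.univ (fun v => G.degree v + 1) hC hbreg
      (a := (c * (1 + δ / 2)) * n) (by positivity) (by
        have := hn G hfree
        rw [hck] at this
        simp only [Finset.card_univ, Fintype.card_fin]
        push_cast
        simp only [add_assoc]
        refine this.trans_eq ?_
        ring)
    rw [Finset.card_univ, Fintype.card_fin] at h
    refine h.trans (mul_le_mul_of_nonneg_left ?_ hn0.le)
    have hlog := Real.log_le_sub_one_of_pos (x := 1 + δ / 2) (by positivity)
    rw [show c * (1 + δ / 2) * n = c * n * (1 + δ / 2) by ring,
      Real.log_mul (by positivity) (by positivity)]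
    linarith
  rw [maxCycleCount, ← Nat.le_floor_iff (by positivity), Finset.sup_le_iff]
  intro G hGm
  exact (Nat.le_floor_iff (by positivity)).mpr (hG G (by simpa using hGm))

theorem theorem1p4 {W : Type*} [Finite W] (H : SimpleGraph W) (k : ℕ) (hk : 2 ≤ k)
    (hH : H.chromaticNumber = ((k + 1 : ℕ) : ℕ∞)) :
    ∃ ε : ℕ → ℝ, Tendsto ε atTop (𝓝 0) ∧
      ∀ n : ℕ, (maxCycleCount n H : ℝ) ≤
        (((k : ℝ) - 1) / (k : ℝ)) ^ n * (n : ℝ) ^ n * Real.exp (-(1 - ε n) * (n : ℝ)) := by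
  classical
  have hcol : H.Colorable (k + 1) := SimpleGraph.chromaticNumber_le_iff_colorable.mp hH.le
  have hk' : (2 : ℝ) ≤ k := by exact_mod_cast hk
  set c : ℝ := ((k : ℝ) - 1) / k with hc
  have hc0 : 0 < c := div_pos (by linarith) (by linarith)
  -- For `n > 0` and a nonzero count, the least nonnegative error making the bound true; truncation
  -- at `0` makes a lower bound on the count unnecessary.
  let ε : ℕ → ℝ := fun n => if maxCycleCount n H = 0 then 0 else
    max 0 (Real.log (maxCycleCount n H) / n - Real.log (c * n) + 1)
  refine ⟨ε, ?_, fun n => ?_⟩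
  -- The form with `n > N` also supplies `n > 0`.
  · rw [Metric.tendsto_atTop']
    intro δ hδ
    obtain ⟨N, hN⟩ := eventually_atTop.mp (eventually_maxCycleCount_le hk hcol (half_pos hδ))
    refine ⟨N, fun n hn => ?_⟩
    have hn0 : (0 : ℝ) < n := by exact_mod_cast (by lia : 0 < n)
    by_cases h0 : maxCycleCount n H = 0
    · simpa [ε, h0] using hδ
    have hpos : (0 : ℝ) < maxCycleCount n H := by exact_mod_cast Nat.pos_of_ne_zero h0
    have h := hN n hn.le
    rw [← Real.log_le_iff_le_exp hpos, ← hc, ← div_le_iff₀' hn0] at h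
    simp only [ε, if_neg h0]
    rw [Real.dist_eq, sub_zero, abs_of_nonneg (le_max_left _ _), max_lt_iff]
    exact ⟨hδ, by linarith⟩
  · by_cases h0 : maxCycleCount n H = 0
    · rw [h0, Nat.cast_zero]
      positivity
    rcases Nat.eq_zero_or_pos n with rfl | hn
    · have hsub : ∀ G : SimpleGraph (Fin 0), cycleCount G = 0 := fun G => by
        rw [cycleCount, Set.ncard_eq_zero]
        exact Set.eq_empty_of_forall_notMem fun _ ⟨v, _⟩ => v.elim0
      simp [maxCycleCount, hsub] at h0
    have hn0 : (0 : ℝ) < n := by exact_mod_cast hn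
    have hpos : (0 : ℝ) < maxCycleCount n H := by exact_mod_cast Nat.pos_of_ne_zero h0
    have hε : Real.log (maxCycleCount n H) / n ≤ Real.log (c * n) - (1 - ε n) := by
      have := le_max_right 0 (Real.log (maxCycleCount n H) / n - Real.log (c * n) + 1)
      simp only [ε, if_neg h0]
      linarith
    rw [div_le_iff₀' hn0, Real.log_le_iff_le_exp hpos] at hε
    refine hε.trans_eq ?_
    rw [← mul_pow, mul_sub, Real.exp_sub, mul_comm (n : ℝ) (Real.log _), Real.exp_mul,
      Real.exp_log (by positivity), Real.rpow_natCast, neg_mul, Real.exp_neg, div_eq_mul_inv,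
      mul_comm (n : ℝ) (1 - ε n)]
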